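/- Let $M_G$ be a finite mixed graph with vertex set $V$ and edge set $E$: a finite simple graph $G=(V,E)$, some of whose edges have been given a direction. Let $N=(n_{ij})$ be the complex $V\times V$ matrix with $n_{ij}=1$ if $ij$ is an undirected edge, $n_{ij}=\frac{1+\sqrt3\,\mathbf i}{2}$ if there is an edge directed from $i$ to $j$, $n_{ij}=\frac{1-\sqrt3\,\mathbf i}{2}$ if there is an edge directed from $j$ to $i$, and $n_{ij}=0$ otherwise. Let $D$ be the diagonal matrix of the degrees in $G$, and let $Q=D+N$. A substructure $M_R$ of $M_G$ is a pair $(V_1,E_1)$ with $V_1\subseteq V$ and $E_1\subseteq E$, where the ends of an edge in $E_1$ need not lie in $V_1$; it is square if $|V_1|=|E_1|$. Its components are given by the connected components of the graph on $V_1$ formed by the edges of $E_1$ with both ends in $V_1$, each taken together with all edges of $E_1$ that have at least one end in it; an edge of $E_1$ with no end in $V_1$ is regarded as a component without vertices. A rootless tree is what remains of a tree when one vertex, but none of the edges, is deleted. A unicyclic graph is a connected graph (all ends of its edges being among its vertices) with exactly one cycle. For a cycle of $M_G$, traversed in one of its two directions, let $a$, $b$ and $c$ be the numbers of its edges that are directed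 along the traversal, directed against it, and undirected, respectively. The cycle belongs to $\Psi_2$ if $a-b\equiv 1,2,4$ or $5\pmod 6$ and $c$ is even, to $\Psi_3$ if $a-b\equiv 0$ or $3\pmod 6$ and $c$ is odd, and to $\Psi_4$ if $a-b\equiv 0$ or $3\pmod 6$ and $c$ is even; this does not depend on the direction of traversal. A unicyclic graph belongs to $\Psi_i$ if its cycle does. A square substructure is called $S\mathrm{II}$ if each of its components is either a rootless tree or a unicyclic graph that does not belong to $\Psi_4$. Then for every $V_1\subseteq V$, writing $Q[V_1]$ for the principal submatrix of $Q$ with rows and columns indexed by $V_1$, $$\det Q[V_1]=\sum_{M_R}3^{\tau_1(M_R)}\,4^{\tau_2(M_R)},$$ where the sum is over all substructures $M_R$ of $M_G$ that are $S\mathrm{II}$ and have vertex set $V_1$, and $\tau_1(M_R)$ and $\tau_2(M_R)$ are the numbers of components of $M_R$ that are unicyclic graphs in $\Psi_2$ and in $\Psi_3$, respectively. (The determinant of the empty matrix is $1$.) -/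

import Mathlib

noncomputable section

/-- A mixed graph on `V`: a simple underlying graph some of whose edges carry a direction.
`arc u v` says that the edge `uv` is directed from `u` to `v`; an edge `uv` with neither
`arc u v` nor `arc v u` is undirected. -/
@[ext]
structure MixedGraph (V : Type*) where
  graph : SimpleGraph V
  arc : V → V → Prop
  adj_of_arc : ∀ u v, arc u v → graph.Adj u v
  arc_asymm : ∀ u v, arc u v → ¬ arc v u

namespace MixedGraph

variable {V : Type*}

/-- The edge `uv` is undirected. -/
def Undirected (M : MixedGraph V) (u v : V) : Prop :=
  M.graph.Adj u v ∧ ¬ M.arc u v ∧ ¬ M.arc v u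

open Classical in
/-- The Hermitian adjacency matrix of the second kind. -/
def hermitianAdjacency (M : MixedGraph V) : Matrix V V ℂ := fun i j =>
  if M.Undirected i j then 1
  else if M.arc i j then (1 + (√3 : ℝ) * Complex.I) / 2
  else if M.arc j i then (1 - (√3 : ℝ) * Complex.I) / 2
  else 0

open Classical in
/-- The diagonal matrix of the degrees in the underlying graph. -/
def degreeMatrix [Fintype V] [DecidableEq V] (M : MixedGraph V) : Matrix V V ℂ :=
  Matrix.diagonal fun v => (M.graph.degree v : ℂ)

/-- The Hermitian quasi-Laplacian matrix of the second kind, `Q = D + N`. -/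
def quasiLaplacian [Fintype V] [DecidableEq V] (M : MixedGraph V) : Matrix V V ℂ :=
  M.degreeMatrix + M.hermitianAdjacency

/-! Mixed cycles, given as closed walks of the underlying graph. -/

open Classical in
/-- The number of edges of the walk `p` that are directed along the direction of travel. -/
def forwardCount (M : MixedGraph V) {u v : V} (p : M.graph.Walk u v) : ℕ :=
  p.darts.countP fun d => decide (M.arc d.fst d.snd)

open Classical in
/-- The number of edges of the walk `p` that are directed against the direction of travel. -/
def backwardCount (M : MixedGraph V) {u v : V} (p : M.graph.Walk u v) : ℕ :=
  p.darts.countP fun d => decide (M.arc d.snd d.fst)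

open Classical in
/-- The number of undirected edges of the walk `p`. -/
def undirectedCount (M : MixedGraph V) {u v : V} (p : M.graph.Walk u v) : ℕ :=
  p.darts.countP fun d => decide (M.Undirected d.fst d.snd)

/-- `a - b` modulo `6`, as an integer in `{0, …, 5}`. -/
def residue (M : MixedGraph V) {u v : V} (p : M.graph.Walk u v) : ℤ :=
  ((M.forwardCount p : ℤ) - (M.backwardCount p : ℤ)) % 6

/-- The cycle `p` belongs to the class `Ψ₂`. -/
def CycleInPsi2 (M : MixedGraph V) {v : V} (p : M.graph.Walk v v) : Prop :=
  M.residue p ∈ ({1, 2, 4, 5} : Set ℤ) ∧ Even (M.undirectedCount p)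

/-- The cycle `p` belongs to the class `Ψ₃`. -/
def CycleInPsi3 (M : MixedGraph V) {v : V} (p : M.graph.Walk v v) : Prop :=
  M.residue p ∈ ({0, 3} : Set ℤ) ∧ Odd (M.undirectedCount p)

/-- The cycle `p` belongs to the class `Ψ₄`. -/
def CycleInPsi4 (M : MixedGraph V) {v : V} (p : M.graph.Walk v v) : Prop :=
  M.residue p ∈ ({0, 3} : Set ℤ) ∧ Even (M.undirectedCount p)

/-- A substructure: a set of vertices together with a set of edges of the mixed graph.  The ends of
an edge of the substructure need not be vertices of the substructure. -/
@[ext]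
structure Substructure (M : MixedGraph V) where
  verts : Set V
  edges : Set (Sym2 V)
  edges_subset : edges ⊆ M.graph.edgeSet

namespace Substructure

variable {M : MixedGraph V}

instance [Finite V] : Finite M.Substructure :=
  Finite.of_injective (fun R : M.Substructure => (R.verts, R.edges)) fun R S h => by
    simp only [Prod.mk.injEq] at h
    exact Substructure.ext h.1 h.2

instance [Finite V] : Fintype M.Substructure := Fintype.ofFinite _

/-- There are as many vertices as edges. -/
def IsSquare (R : M.Substructure) : Prop := R.verts.ncard = R.edges.ncard

/-- The graph on the vertices of `R` formed by those edges of `R` that have both ends in `R`. -/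
def graph (R : M.Substructure) : SimpleGraph R.verts :=
  (SimpleGraph.fromEdgeSet R.edges).induce R.verts

/-- The substructure formed by the vertices of a connected component `c` and all edges of `R` that
have at least one end in `c`. -/
def component (R : M.Substructure) (c : R.graph.ConnectedComponent) : M.Substructure where
  verts := Subtype.val '' c.supp
  edges := {e | e ∈ R.edges ∧ ∃ v ∈ Subtype.val '' c.supp, v ∈ e}
  edges_subset := fun _ he => R.edges_subset he.1

/-- `R` is a rootless tree: it arises from a tree by deleting one vertex `u`, the root, and no edge.
So `R` together with `u` is a tree, all of whose edges are those of `R`. -/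
def IsRootlessTree (R : M.Substructure) : Prop :=
  ∃ u, u ∉ R.verts ∧ (∀ e ∈ R.edges, ∀ x ∈ e, x ∈ insert u R.verts) ∧
    ((SimpleGraph.fromEdgeSet R.edges).induce (insert u R.verts)).IsTree

/-- The closed walk `p` is a cycle lying in `R`. -/
def IsCycleIn (R : M.Substructure) {v : V} (p : M.graph.Walk v v) : Prop :=
  p.IsCycle ∧ (∀ x ∈ p.support, x ∈ R.verts) ∧ ∀ e ∈ p.edges, e ∈ R.edges

/-- `R` is a unicyclic graph: a connected graph (every edge has both its ends in `R`) with exactly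
one cycle, where a cycle is identified with its set of edges. -/
def IsUnicyclic (R : M.Substructure) : Prop :=
  (∀ e ∈ R.edges, ∀ x ∈ e, x ∈ R.verts) ∧ R.graph.Connected ∧
    ∃! s : Set (Sym2 V), ∃ (v : V) (p : M.graph.Walk v v), R.IsCycleIn p ∧ {e | e ∈ p.edges} = s

/-- A unicyclic graph whose cycle is in `Ψ₂`.  (Running through the cycle in the other direction
exchanges `a` and `b`, which does not affect membership in the classes `Ψᵢ`.) -/
def UnicyclicInPsi2 (R : M.Substructure) : Prop :=
  R.IsUnicyclic ∧ ∃ (v : V) (p : M.graph.Walk v v), R.IsCycleIn p ∧ M.CycleInPsi2 p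

/-- A unicyclic graph whose cycle is in `Ψ₃`. -/
def UnicyclicInPsi3 (R : M.Substructure) : Prop :=
  R.IsUnicyclic ∧ ∃ (v : V) (p : M.graph.Walk v v), R.IsCycleIn p ∧ M.CycleInPsi3 p

/-- A unicyclic graph whose cycle is in `Ψ₄`. -/
def UnicyclicInPsi4 (R : M.Substructure) : Prop :=
  R.IsUnicyclic ∧ ∃ (v : V) (p : M.graph.Walk v v), R.IsCycleIn p ∧ M.CycleInPsi4 p

/-- `R` is a substructure II: a square substructure each of whose components is a rootless tree or
a unicyclic graph that is not in `Ψ₄`.  The second clause says that there is no degenerate component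
consisting of an edge without its ends. -/
def IsSII (R : M.Substructure) : Prop :=
  R.IsSquare ∧ (∀ e ∈ R.edges, ∃ v ∈ R.verts, v ∈ e) ∧
    ∀ c : R.graph.ConnectedComponent, (R.component c).IsRootlessTree ∨
      ((R.component c).IsUnicyclic ∧ ¬ (R.component c).UnicyclicInPsi4)

/-- The number of components of `R` that are unicyclic graphs in `Ψ₂`. -/
def tau1 (R : M.Substructure) : ℕ :=
  {c : R.graph.ConnectedComponent | (R.component c).UnicyclicInPsi2}.ncard

/-- The number of components of `R` that are unicyclic graphs in `Ψ₃`. -/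
def tau2 (R : M.Substructure) : ℕ :=
  {c : R.graph.ConnectedComponent | (R.component c).UnicyclicInPsi3}.ncard

end Substructure

end MixedGraph

end

/-! Every nonzero entry of `N` has modulus one, so `Q` factors as `S Sᴴ`, where column `e` of the
incidence matrix `S` is supported on the two ends of `e`. Cauchy–Binet writes the minor on `V₁` as a
sum over edge sets `T` with `|T| = |V₁|` of `gramDet V₁ T`, which is `|det S[V₁, T]|²`.

Each summand is a product over the components of `(V₁, T)` (`gramDet_eq_prod_component`). It
vanishes if some edge has no end in `V₁`, or if some component is not square, since then some
component has fewer edges than vertices. A connected square component is a rootless tree or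
unicyclic (`isRootlessTree_or_isUnicyclic`). For a rootless tree, matching every vertex with the
edge towards the root makes `S` triangular with unimodular diagonal, so the factor is 1
(`gramDet_eq_one_of_pendant`). For a unicyclic graph the factor is `|1 - w|²`, with `w` the product
of the entries `-n` along the cycle (`gramDet_eq_of_closed_walk`). Since `w` is a cube root of unity
up to sign, this is 0 on `Ψ₄`, 4 on `Ψ₃`, 3 on `Ψ₂` and 1 otherwise (`one_sub_negWeight_mul_star`).
-/

noncomputable section

/-! ### Determinants: Cauchy–Binet, triangular and block diagonal matrices. -/

namespace Matrix

open Finset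

variable {m E R : Type*} [Fintype m] [DecidableEq m]

/-- Expansion of the determinant of a product along the rows of the second factor. -/
theorem det_sum_mul_eq_sum_piFinset [CommRing R] (A : Matrix m E R) (B : Matrix E m R)
    (T : Finset E) :
    (Matrix.of fun i j => ∑ e ∈ T, A i e * B e j).det =
      ∑ f ∈ Fintype.piFinset fun _ : m => T, (∏ i, A i (f i)) * (B.submatrix f id).det := by
  have h := (detRowAlternating (n := m) (R := R)).toMultilinearMap.map_sum_finset
    (fun i e => A i e • B e) (fun _ => T)
  have h2 : (Matrix.of fun i j => ∑ e ∈ T, A i e * B e j) = fun i => ∑ e ∈ T, A i e • B e := by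
    ext i j
    simp [Finset.sum_apply]
  rw [h2]
  refine h.trans (Finset.sum_congr rfl fun f _ => ?_)
  exact MultilinearMap.map_smul_univ _ (fun i => A i (f i)) (fun i => B (f i))

/-- The Cauchy–Binet formula. -/
theorem det_mul_eq_sum_powersetCard [Fintype E] [DecidableEq E] [CommRing R] (A : Matrix m E R) (B : Matrix E m R) :
    (A * B).det = ∑ T ∈ powersetCard (Fintype.card m) (univ : Finset E),
      (Matrix.of fun i j => ∑ e ∈ T, A i e * B e j).det := by
  have h0 : A * B = Matrix.of fun i j => ∑ e ∈ univ, A i e * B e j := by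
    ext i j
    simp [Matrix.mul_apply]
  rw [h0]
  simp only [det_sum_mul_eq_sum_piFinset]
  have hsub : ∀ T : Finset E, (Fintype.piFinset fun _ : m => T) =
      (univ : Finset (m → E)).filter fun f => ∀ i, f i ∈ T := by
    intro T; ext f; simp
  simp only [hsub, Finset.sum_filter]
  rw [Finset.sum_comm]
  refine Finset.sum_congr rfl fun f _ => ?_
  simp only [mem_univ, implies_true, if_true]
  -- An injective `f` takes its values in exactly one `T` of the given size, its image; for any
  -- other `f` the minor of `B` has two equal rows.
  by_cases hf : Function.Injective f
  · rw [Finset.sum_eq_single (univ.image f)]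
    · simp
    · intro T hT hne
      rw [if_neg]
      intro h
      refine hne (Finset.eq_of_subset_of_card_le ?_ ?_).symm
      · intro e he
        obtain ⟨i, -, rfl⟩ := Finset.mem_image.1 he
        exact h i
      · rw [(mem_powersetCard.1 hT).2, Finset.card_image_of_injective _ hf, Finset.card_univ]
    · intro h
      refine absurd (mem_powersetCard.2 ⟨subset_univ _, ?_⟩) h
      rw [Finset.card_image_of_injective _ hf, Finset.card_univ]
  · have : (B.submatrix f id).det = 0 := by
      simp only [Function.Injective, not_forall] at hf
      obtain ⟨i, j, hij, hne⟩ := hf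
      refine det_zero_of_row_eq hne ?_
      ext k
      simp [hij]
    simp [this]

/-- The rank is at most `T.card`; in the expansion, pigeonhole gives every minor of `B` two equal
rows. -/
theorem det_sum_mul_eq_zero_of_card_lt [CommRing R] (A : Matrix m E R) (B : Matrix E m R)
    (T : Finset E) (hT : T.card < Fintype.card m) :
    (Matrix.of fun i j => ∑ e ∈ T, A i e * B e j).det = 0 := by
  rw [det_sum_mul_eq_sum_piFinset]
  refine Finset.sum_eq_zero fun f hf => ?_
  have hf' : ∃ x ∈ (univ : Finset m), ∃ y ∈ (univ : Finset m), x ≠ y ∧ f x = f y :=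
    Finset.exists_ne_map_eq_of_card_lt_of_maps_to (t := T) (by simpa using hT)
      fun i _ => Fintype.mem_piFinset.1 hf i
  obtain ⟨i, -, j, -, hne, hij⟩ := hf'
  rw [det_zero_of_row_eq hne, mul_zero]
  ext k
  simp [hij]

/-- The determinant of a matrix that is triangular with respect to a height function. -/
theorem det_eq_prod_diag_of_height [CommRing R] (A : Matrix m m R) (b : m → ℕ)
    (h : ∀ i j, A i j ≠ 0 → i = j ∨ b i < b j) : A.det = ∏ i, A i i := by
  rw [det_apply, Finset.sum_eq_single 1]
  · simp
  · intro σ _ hσ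
    suffices h0 : ∏ i, A (σ i) i = 0 by rw [h0, smul_zero]
    by_contra hne
    have hall : ∀ i, σ i = i ∨ b (σ i) < b i := fun i =>
      h _ _ fun h0 => hne (Finset.prod_eq_zero (mem_univ i) h0)
    obtain ⟨i, hi⟩ : ∃ i, σ i ≠ i := by
      by_contra hcon
      push Not at hcon
      exact hσ (Equiv.ext hcon)
    -- A nonzero term lowers the height at every point moved by `σ`, yet `σ` preserves the sum of
    -- all heights.
    have hlt : ∑ i, b (σ i) < ∑ i, b i := by
      refine Finset.sum_lt_sum (fun j _ => ?_) ⟨i, mem_univ _, (hall i).resolve_left hi⟩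
      rcases hall j with hj | hj
      · rw [hj]
      · exact hj.le
    exact hlt.ne (Equiv.sum_comp σ b)
  · simp

theorem det_eq_prod_of_block_diagonal [CommRing R] {α : Type*} [Fintype α] [DecidableEq α]
    (A : Matrix m m R) (b : m → α) (h : ∀ i j, b i ≠ b j → A i j = 0) :
    A.det = ∏ k : α, (A.submatrix (fun v : {v // b v = k} => (v : m))
      (fun v : {v // b v = k} => (v : m))).det := by
  -- Any linear order on the blocks makes the matrix block triangular; this one is borrowed from
  -- `Fin`.
  let e := Fintype.equivFin α
  have h1 : A.BlockTriangular (e ∘ b) := fun i j hij => h i j fun hb => by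
    simp [hb] at hij
  rw [h1.det_fintype, ← Equiv.prod_comp e]
  refine Finset.prod_congr rfl fun k _ => ?_
  let g : {v // b v = k} ≃ {v // (e ∘ b) v = e k} :=
    Equiv.subtypeEquivRight fun v => by simp
  rw [← det_submatrix_equiv_self g]
  rfl

end Matrix

end

/-! ### The factorisation of `Q` by an incidence matrix, and edge sets with a pendant edge. -/

noncomputable section

namespace MixedGraph

open Matrix

variable {V : Type*} (M : MixedGraph V)

theorem star_hermitianAdjacency (i j : V) :
    star (M.hermitianAdjacency i j) = M.hermitianAdjacency j i := by
  have hu : M.Undirected i j ↔ M.Undirected j i := by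
    simp only [Undirected, M.graph.adj_comm i j]
    tauto
  have ha := M.arc_asymm i j
  simp only [hermitianAdjacency, hu]
  split_ifs <;> first | (exfalso; tauto) | simp [Complex.ext_iff]

theorem hermitianAdjacency_of_not_adj {i j : V} (h : ¬ M.graph.Adj i j) :
    M.hermitianAdjacency i j = 0 := by
  have h1 : ¬ M.arc i j := fun ha => h (M.adj_of_arc _ _ ha)
  have h2 : ¬ M.arc j i := fun ha => h (M.adj_of_arc _ _ ha).symm
  simp [hermitianAdjacency, Undirected, h, h1, h2]

theorem hermitianAdjacency_mul_star {i j : V} (h : M.graph.Adj i j) :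
    M.hermitianAdjacency i j * star (M.hermitianAdjacency i j) = 1 := by
  have h3 : √3 * √3 = (3 : ℝ) := Real.mul_self_sqrt (by norm_num)
  unfold hermitianAdjacency
  by_cases hu : M.Undirected i j
  · simp [hu]
  by_cases h1 : M.arc i j
  · simp only [hu, h1, if_true, if_false]
    apply Complex.ext
    · simp; nlinarith
    · simp; ring
  by_cases h2 : M.arc j i
  · simp only [hu, h1, h2, if_true, if_false]
    apply Complex.ext
    · simp; nlinarith
    · simp; ring
  · exact absurd ⟨h, h1, h2⟩ hu

open Classical in
/-- An incidence matrix of the second kind, based on a choice of a first end for each edge. -/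
def incidence : Matrix V (Sym2 V) ℂ := fun v e =>
  if v ∈ e ∧ e ∈ M.graph.edgeSet then
    if v = (Quot.out e).1 then 1 else M.hermitianAdjacency v (Quot.out e).1
  else 0

variable {M}

theorem incidence_of_notMem {v : V} {e : Sym2 V} (h : v ∉ e) : M.incidence v e = 0 := by
  simp [incidence, h]

theorem incidence_of_notMem_edgeSet {v : V} {e : Sym2 V} (h : e ∉ M.graph.edgeSet) :
    M.incidence v e = 0 := by
  simp [incidence, h]

theorem incidence_mul_star_self {v : V} {e : Sym2 V} (hv : v ∈ e) (he : e ∈ M.graph.edgeSet) :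
    M.incidence v e * star (M.incidence v e) = 1 := by
  simp only [incidence, hv, he, true_and, if_true]
  split_ifs with h
  · simp
  · refine M.hermitianAdjacency_mul_star ?_
    have : e = s(v, (Quot.out e).1) := (Sym2.mem_and_mem_iff h).1 ⟨hv, Sym2.out_fst_mem e⟩
    rw [this] at he
    exact he

/-- The product is `1 * star n_ji` or `n_ij * 1` according to which end is the first, so the choice
made in `incidence` cancels. -/
theorem incidence_mul_star {i j : V} (h : M.graph.Adj i j) :
    M.incidence i s(i, j) * star (M.incidence j s(i, j)) = M.hermitianAdjacency i j := by
  have he : s(i, j) ∈ M.graph.edgeSet := h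
  have hne := h.ne
  have hm := Sym2.out_fst_mem s(i, j)
  simp only [incidence, he, Sym2.mem_mk_left, Sym2.mem_mk_right, true_and, if_true]
  generalize (Quot.out s(i, j)).1 = a at hm ⊢
  rcases Sym2.mem_iff.1 hm with rfl | rfl
  · rw [if_pos rfl, if_neg hne.symm, star_hermitianAdjacency, one_mul]
  · rw [if_neg hne, if_pos rfl, star_one, mul_one]

theorem quasiLaplacian_eq_incidence_mul [Fintype V] [DecidableEq V] (M : MixedGraph V) :
    M.quasiLaplacian = M.incidence * M.incidenceᴴ := by
  classical
  ext i j
  rw [quasiLaplacian, degreeMatrix, Matrix.add_apply, Matrix.mul_apply]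
  simp only [conjTranspose_apply]
  by_cases hij : i = j
  · subst hij
    rw [diagonal_apply_eq, M.hermitianAdjacency_of_not_adj (M.graph.irrefl), add_zero,
      ← M.graph.card_incidenceFinset_eq_degree, Finset.card_eq_sum_ones, Nat.cast_sum,
      ← Finset.sum_subset (Finset.subset_univ (M.graph.incidenceFinset i))]
    · refine Finset.sum_congr rfl fun e he => ?_
      rw [SimpleGraph.mem_incidenceFinset] at he
      rw [incidence_mul_star_self he.2 he.1, Nat.cast_one]
    · intro e _ he
      rw [SimpleGraph.mem_incidenceFinset] at he
      by_cases h1 : e ∈ M.graph.edgeSet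
      · rw [incidence_of_notMem fun h2 => he ⟨h1, h2⟩, zero_mul]
      · rw [incidence_of_notMem_edgeSet h1, zero_mul]
  · rw [diagonal_apply_ne _ hij, zero_add, Finset.sum_eq_single s(i, j)]
    · by_cases h : M.graph.Adj i j
      · rw [incidence_mul_star h]
      · rw [M.hermitianAdjacency_of_not_adj h,
          incidence_of_notMem_edgeSet (e := s(i, j)) (by simpa using h), zero_mul]
    · intro e _ he
      by_cases hi : i ∈ e
      · rw [incidence_of_notMem (v := j) fun hj => he ((Sym2.mem_and_mem_iff hij).1 ⟨hi, hj⟩),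
          star_zero, mul_zero]
      · rw [incidence_of_notMem hi, zero_mul]
    · simp

/-- Each `v ≠ r` takes the first edge of a shortest path to `r`, and `r` takes the spare edge `h`.
Two vertices with the same edge would each be nearer to `r` than the other, so the map is injective,
and the count makes it bijective. It pairs rows with columns so that the incidence matrix becomes
triangular for the distance to `r`. -/
theorem exists_equiv_toward_root [Finite V] (W : Set V) (F : Set (Sym2 V)) (hcard : W.ncard = F.ncard)
    (G : SimpleGraph W) (hG : G.Connected) (r : W) {h : Sym2 V} (hF : h ∈ F)
    (hGF : ∀ v w, G.Adj v w → s(v.1, w.1) ∈ F ∧ s(v.1, w.1) ≠ h) :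
    ∃ f : W ≃ F, (f r).1 = h ∧
      ∀ v, v ≠ r → ∃ w, G.Adj v w ∧ G.dist w r < G.dist v r ∧ (f v).1 = s(v.1, w.1) := by
  classical
  have hstep : ∀ v, v ≠ r → ∃ w, G.Adj v w ∧ G.dist w r < G.dist v r := by
    intro v hv
    obtain ⟨p, hp⟩ := hG.exists_walk_length_eq_dist v r
    cases p with
    | nil => exact absurd rfl hv
    | cons hadj q =>
      refine ⟨_, hadj, ?_⟩
      rw [← hp, SimpleGraph.Walk.length_cons]
      exact Nat.lt_succ_of_le (SimpleGraph.dist_le q)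
  choose! p hp using hstep
  let f : W → F := fun v => if hv : v = r then ⟨h, hF⟩ else ⟨s(v.1, (p v).1), (hGF _ _ (hp v hv).1).1⟩
  have hfr : (f r).1 = h := by simp [f]
  have hfv : ∀ v, v ≠ r → (f v).1 = s(v.1, (p v).1) := fun v hv => by simp [f, hv]
  have hinj : Function.Injective f := by
    intro v w hvw
    have hvw' := congrArg Subtype.val hvw
    by_cases hv : v = r
    · by_cases hw : w = r
      · rw [hv, hw]
      · subst hv
        rw [hfr, hfv w hw] at hvw'
        exact absurd hvw'.symm (hGF _ _ (hp w hw).1).2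
    · by_cases hw : w = r
      · subst hw
        rw [hfr, hfv v hv] at hvw'
        exact absurd hvw' (hGF _ _ (hp v hv).1).2
      · rw [hfv v hv, hfv w hw, Sym2.eq_iff] at hvw'
        rcases hvw' with ⟨h1, -⟩ | ⟨h1, h2⟩
        · exact Subtype.ext h1
        · have h1' : v = p w := Subtype.ext h1
          have h2' : p v = w := Subtype.ext h2
          have a := (hp v hv).2
          have b := (hp w hw).2
          rw [h2'] at a
          rw [← h1'] at b
          exact absurd (a.trans b) (lt_irrefl _)
  have hbij : Function.Bijective f := by
    have := Fintype.ofFinite V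
    rw [Fintype.bijective_iff_injective_and_card]
    refine ⟨hinj, ?_⟩
    rwa [← Nat.card_eq_fintype_card, ← Nat.card_eq_fintype_card, Nat.card_coe_set_eq,
      Nat.card_coe_set_eq]
  exact ⟨Equiv.ofBijective f hbij, hfr, fun v hv => ⟨p v, (hp v hv).1, (hp v hv).2, hfv v hv⟩⟩

variable [Fintype V]

open Classical in
/-- The determinant of the quasi-Laplacian that counts only the edges in `F`, restricted to `W`. -/
def gramDet (M : MixedGraph V) (W : Set V) (F : Set (Sym2 V)) : ℂ :=
  (Matrix.of fun i j : W =>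
    ∑ e ∈ F.toFinset, M.incidence i e * star (M.incidence j e)).det

theorem gramDet_eq_det_of_equiv {ι : Type*} [Fintype ι] [DecidableEq ι] {W : Set V}
    (T : Finset (Sym2 V)) (g : ι ≃ W) : M.gramDet W T =
      (Matrix.of fun i j : ι => ∑ e ∈ T, M.incidence (g i) e * star (M.incidence (g j) e)).det := by
  classical
  rw [gramDet, Finset.toFinset_coe, ← det_submatrix_equiv_self g]
  rfl

theorem gramDet_eq_zero_of_ncard_lt (W : Set V) (F : Set (Sym2 V)) (h : F.ncard < W.ncard) :
    M.gramDet W F = 0 := by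
  classical
  refine det_sum_mul_eq_zero_of_card_lt (M.incidence.submatrix (fun v : W => (v : V)) id)
    (M.incidenceᴴ.submatrix id (fun v : W => (v : V))) F.toFinset ?_
  rwa [← Set.ncard_eq_toFinset_card', ← Nat.card_eq_fintype_card, Nat.card_coe_set_eq]

theorem gramDet_diff_singleton (W : Set V) (F : Set (Sym2 V)) (e : Sym2 V)
    (h : ∀ v ∈ W, M.incidence v e = 0) : M.gramDet W (F \ {e}) = M.gramDet W F := by
  classical
  rw [gramDet, gramDet]
  congr 1
  ext i j
  simp only [Matrix.of_apply]
  refine Finset.sum_subset (fun x => by simp +contextual) fun x hx hx' => ?_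
  have : x = e := by
    by_contra hne
    simp_all
  rw [this, h i i.2, zero_mul]

/-- Dropping the edge `e` does not change the matrix but leaves too few edges. -/
theorem gramDet_eq_zero_of_column_eq_zero (W : Set V) (F : Set (Sym2 V)) (e : Sym2 V)
    (hcard : W.ncard = F.ncard) (he : e ∈ F) (h : ∀ v ∈ W, M.incidence v e = 0) :
    M.gramDet W F = 0 := by
  rw [← gramDet_diff_singleton W F e h]
  refine gramDet_eq_zero_of_ncard_lt _ _ ?_
  rw [hcard]
  exact Set.ncard_sdiff_singleton_lt_of_mem he

open Classical in
theorem gramDet_eq_det_mul_star_det (W : Set V) (F : Set (Sym2 V)) (f : W ≃ F) :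
    M.gramDet W F = (Matrix.of fun v w : W => M.incidence v (f w)).det *
      star (Matrix.of fun v w : W => M.incidence v (f w)).det := by
  rw [← det_conjTranspose, ← det_mul, gramDet]
  congr 1
  ext i j
  simp only [Matrix.of_apply, Matrix.mul_apply, conjTranspose_apply]
  rw [f.sum_comp fun e : F => M.incidence i e * star (M.incidence j e)]
  refine Finset.sum_subtype _ (fun x => ?_) _
  simp

/-- The root takes the pendant edge, whose other end `u` has no row. Every other column has its
diagonal entry and one entry at a vertex nearer to `r`, so the matrix is triangular with unimodular
diagonal. -/
theorem gramDet_eq_one_of_pendant (W : Set V) (F : Set (Sym2 V)) (hFE : F ⊆ M.graph.edgeSet)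
    (hcard : W.ncard = F.ncard) (G : SimpleGraph W) (hG : G.Connected)
    (hGF : ∀ v w, G.Adj v w → s(v.1, w.1) ∈ F) (r : W) (u : V) (hu : u ∉ W)
    (hF : s(r.1, u) ∈ F) : M.gramDet W F = 1 := by
  classical
  obtain ⟨f, hfr, hf⟩ := exists_equiv_toward_root W F hcard G hG r hF fun v w hvw =>
    ⟨hGF v w hvw, fun he => hu <| by
      have := Sym2.mem_mk_right r.1 u
      rw [← he, Sym2.mem_iff] at this
      rcases this with rfl | rfl
      · exact v.2
      · exact w.2⟩
  have hmem : ∀ v : W, v.1 ∈ (f v).1 := by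
    intro v
    by_cases hv : v = r
    · subst hv
      rw [hfr]
      exact Sym2.mem_mk_left _ _
    · obtain ⟨w, -, -, h⟩ := hf v hv
      rw [h]
      exact Sym2.mem_mk_left _ _
  rw [gramDet_eq_det_mul_star_det W F f,
    det_eq_prod_diag_of_height _ fun v => G.dist v r, star_prod, ← Finset.prod_mul_distrib]
  · exact Finset.prod_eq_one fun v _ => incidence_mul_star_self (hmem v) (hFE (f v).2)
  · intro v w hvw
    have hv : v.1 ∈ (f w).1 := by
      by_contra hcon
      exact hvw (incidence_of_notMem hcon)
    by_cases hw : w = r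
    · rw [hw, hfr, Sym2.mem_iff] at hv
      left
      rcases hv with hv | hv
      · rw [hw]; exact Subtype.ext hv
      · exact absurd (hv ▸ v.2) hu
    · obtain ⟨x, -, hlt, h⟩ := hf w hw
      rw [h, Sym2.mem_iff] at hv
      rcases hv with hv | hv
      · exact Or.inl (Subtype.ext hv)
      · right
        rw [show v = x from Subtype.ext hv]
        exact hlt

end MixedGraph

end

/-! ### The determinant of a unicyclic graph in terms of the weight of its cycle. -/

noncomputable section

namespace MixedGraph

open Matrix

variable {V : Type*} {M : MixedGraph V}

/-- The product of the entries `-n` of the adjacency matrix along a walk. -/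
def negWeight (M : MixedGraph V) {u v : V} (p : M.graph.Walk u v) : ℂ :=
  (p.darts.map fun d => -M.hermitianAdjacency d.fst d.snd).prod

theorem negWeight_cons {u v w : V} (h : M.graph.Adj u v) (p : M.graph.Walk v w) :
    M.negWeight (p.cons h) = -M.hermitianAdjacency u v * M.negWeight p := by
  simp [negWeight]

/-- A row vector annihilating the column of an edge is carried across that edge by the factor `-n`;
hence the weight of a walk is a product of such factors. -/
theorem potential_step {x y : V} (h : M.graph.Adj x y) {a b : ℂ}
    (hab : a * M.incidence x s(x, y) + b * M.incidence y s(x, y) = 0) :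
    b = -M.hermitianAdjacency x y * a := by
  have h1 := incidence_mul_star_self (Sym2.mem_mk_right x y)
    (show s(x, y) ∈ M.graph.edgeSet from h)
  rw [← incidence_mul_star h]
  linear_combination (star (M.incidence y s(x, y))) * hab - b * h1

theorem potential_walk (F : Set (Sym2 V)) (d : V → ℂ)
    (hd : ∀ x y, M.graph.Adj x y → s(x, y) ∈ F →
      d x * M.incidence x s(x, y) + d y * M.incidence y s(x, y) = 0)
    {u v : V} (p : M.graph.Walk u v) (hp : ∀ e ∈ p.edges, e ∈ F) :
    d v = M.negWeight p * d u := by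
  induction p with
  | nil => simp [negWeight]
  | cons h p ih =>
    simp only [SimpleGraph.Walk.edges_cons, List.mem_cons, forall_eq_or_imp] at hp
    rw [ih hp.2, negWeight_cons, potential_step h (hd _ _ h hp.1)]
    ring

variable [Fintype V]

open Classical in
theorem sum_mul_incidence (W : Set V) (d : W → ℂ) (x y : W) (hxy : x ≠ y) :
    ∑ v : W, d v * M.incidence v s(x.1, y.1) =
      d x * M.incidence x s(x.1, y.1) + d y * M.incidence y s(x.1, y.1) := by
  refine Fintype.sum_eq_add x y hxy fun v hv => ?_
  rw [incidence_of_notMem, mul_zero]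
  rw [Sym2.mem_iff, not_or]
  exact ⟨fun h => hv.1 (Subtype.ext h), fun h => hv.2 (Subtype.ext h)⟩

/-- Let `d` be a nonzero row vector annihilating every column of `S` except that of the edge `v₀u₀`.
Transport makes `|d|` constant on the connected graph `G`. Replacing row `r` by `d S` multiplies the
determinant by `d r` and leaves a triangular matrix whose diagonal is unimodular apart from `δ`, so
`|d r|² |det S|² = |δ|²`. Transport along `q` shows that `δ` is `d t` times a unimodular number
times `1 - w`. -/
theorem gramDet_eq_of_closed_walk (W : Set V) (F : Set (Sym2 V)) (hFE : F ⊆ M.graph.edgeSet)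
    (hFW : ∀ e ∈ F, ∀ x ∈ e, x ∈ W) (hcard : W.ncard = F.ncard)
    {v₀ u₀ : V} (h₀ : M.graph.Adj v₀ u₀) (hF : s(v₀, u₀) ∈ F) (q : M.graph.Walk u₀ v₀)
    (hq : ∀ e ∈ q.edges, e ∈ F \ {s(v₀, u₀)}) (G : SimpleGraph W) (hG : G.Connected)
    (hGF : ∀ v w, G.Adj v w → s(v.1, w.1) ∈ F ∧ s(v.1, w.1) ≠ s(v₀, u₀)) :
    M.gramDet W F =
      (1 - M.negWeight (q.cons h₀)) * star (1 - M.negWeight (q.cons h₀)) := by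
  classical
  obtain ⟨r, hr⟩ : ∃ r : W, r.1 = v₀ := ⟨⟨v₀, hFW _ hF _ (Sym2.mem_mk_left _ _)⟩, rfl⟩
  obtain ⟨t, ht⟩ : ∃ t : W, t.1 = u₀ := ⟨⟨u₀, hFW _ hF _ (Sym2.mem_mk_right _ _)⟩, rfl⟩
  have hrt : r ≠ t := fun h => h₀.ne (by rw [← hr, ← ht, h])
  obtain ⟨f, hfr, hf⟩ := exists_equiv_toward_root W F hcard G hG r hF hGF
  set S : Matrix W W ℂ := Matrix.of fun v w : W => M.incidence v (f w) with hS
  -- Column `r` belongs to the edge `v₀u₀`; zeroing it makes the matrix singular.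
  obtain ⟨d, hd0, hd⟩ := exists_vecMul_eq_zero_iff.2
    (det_eq_zero_of_column_eq_zero (A := S.updateCol r 0) r (by simp))
  have hrel : ∀ x y : W, x ≠ y → s(x.1, y.1) ∈ F → s(x.1, y.1) ≠ s(v₀, u₀) →
      d x * M.incidence x s(x.1, y.1) + d y * M.incidence y s(x.1, y.1) = 0 := by
    intro x y hxy he hne
    rw [← sum_mul_incidence W d x y hxy]
    obtain ⟨w, hw⟩ := f.surjective ⟨_, he⟩
    have hwr : w ≠ r := by
      rintro rfl
      rw [hw] at hfr
      exact hne hfr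
    have := congrFun hd w
    simpa [vecMul, dotProduct, updateCol_ne hwr, hS, hw] using this
  have hwalk : ∀ u v, G.Walk u v → d u * star (d u) = d v * star (d v) := by
    intro u v p
    induction p with
    | nil => rfl
    | @cons a b c h p ih =>
      have hF' := hGF _ _ h
      have hadj : M.graph.Adj a.1 b.1 := hFE hF'.1
      rw [← ih, potential_step hadj (hrel a b h.ne hF'.1 hF'.2), star_mul']
      have h1 := M.hermitianAdjacency_mul_star hadj
      rw [star_neg]
      linear_combination (-(d a * star (d a))) * h1
  have hmod : ∀ v, d v * star (d v) = d r * star (d r) := fun v =>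
    (hG.preconnected v r).elim (hwalk v r)
  have hdr : d r * star (d r) ≠ 0 := by
    intro h
    refine hd0 (funext fun v => ?_)
    have := hmod v
    rw [h] at this
    rcases mul_eq_zero.1 this with h' | h'
    · exact h'
    · exact star_eq_zero.1 h'
  have hclosed : d r = M.negWeight q * d t := by
    -- The value 0 outside `W` is harmless because edges of `F` have both ends in `W`.
    have := potential_walk (F \ {s(v₀, u₀)}) (fun v => if hv : v ∈ W then d ⟨v, hv⟩ else 0)
      (fun x y hxy he => ?_) q hq
    · simpa [← hr, ← ht] using this
    · have hx := hFW _ he.1 _ (Sym2.mem_mk_left x y)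
      have hy := hFW _ he.1 _ (Sym2.mem_mk_right x y)
      simpa [hx, hy] using hrel ⟨x, hx⟩ ⟨y, hy⟩ (fun h => hxy.ne (congrArg Subtype.val h)) he.1 he.2
  set δ : ℂ := ∑ v : W, d v * M.incidence v s(v₀, u₀) with hδ
  have hδ' : δ * star δ = d r * star (d r) *
      ((1 - M.negWeight (q.cons h₀)) * star (1 - M.negWeight (q.cons h₀))) := by
    have h1 : δ = d t * M.incidence u₀ s(v₀, u₀) * (1 - M.negWeight (q.cons h₀)) := by
      rw [hδ]
      have := sum_mul_incidence (M := M) W d r t hrt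
      rw [hr, ht] at this
      rw [this, hclosed, negWeight_cons, ← incidence_mul_star h₀]
      have h2 := incidence_mul_star_self (M := M) (Sym2.mem_mk_right v₀ u₀)
        (show s(v₀, u₀) ∈ M.graph.edgeSet from h₀)
      linear_combination (-(M.negWeight q * d t * M.incidence v₀ s(v₀, u₀))) * h2
    rw [h1, ← hmod t]
    simp only [star_mul']
    have h2 := incidence_mul_star_self (M := M) (Sym2.mem_mk_right v₀ u₀)
      (show s(v₀, u₀) ∈ M.graph.edgeSet from h₀)
    linear_combination (d t * star (d t) * (1 - M.negWeight (q.cons h₀)) *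
      star (1 - M.negWeight (q.cons h₀))) * h2
  set A := S.updateRow r (∑ k, d k • S k) with hA
  have hAr : ∀ j, A r j = if j = r then δ else 0 := by
    intro j
    rw [hA, updateRow_self, Finset.sum_apply]
    split_ifs with hj
    · subst hj
      simp [hS, hδ, hfr]
    · have := congrFun hd j
      simpa [vecMul, dotProduct, updateCol_ne hj] using this
  have hAv : ∀ v, v ≠ r → ∀ j, A v j = M.incidence v (f j) := by
    intro v hv j
    rw [hA, updateRow_ne hv, hS, Matrix.of_apply]
  have hdetA : A.det = d r * S.det := det_updateRow_sum S r d
  have hdetA' : A.det = ∏ v, A v v := by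
    -- Column `r` may have an entry in another row, so `r` must lie above all other vertices. Giving
    -- up its distance 0 costs nothing, because row `r` is now zero off the diagonal.
    refine det_eq_prod_diag_of_height A
      (fun v => if v = r then (∑ w, G.dist w r) + 1 else G.dist v r) fun v w hvw => ?_
    by_cases hv : v = r
    · subst hv
      rw [hAr] at hvw
      left
      by_contra hne
      simp [Ne.symm hne] at hvw
    · rw [hAv v hv] at hvw
      have hmem : v.1 ∈ (f w).1 := by
        by_contra hcon
        exact hvw (incidence_of_notMem hcon)
      by_cases hw : w = r
      · right
        simp only [hv, hw, if_true, if_false]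
        exact Nat.lt_succ_of_le
          (Finset.single_le_sum (f := fun w => G.dist w r) (fun _ _ => Nat.zero_le _)
            (Finset.mem_univ v))
      · obtain ⟨x, -, hlt, h⟩ := hf w hw
        rw [h, Sym2.mem_iff] at hmem
        rcases hmem with hmem | hmem
        · exact Or.inl (Subtype.ext hmem)
        · right
          simp only [hv, hw, if_false]
          rw [show v = x from Subtype.ext hmem]
          exact hlt
  have hprod : A.det * star A.det = δ * star δ := by
    rw [hdetA', star_prod, ← Finset.prod_mul_distrib, Fintype.prod_eq_single r]
    · rw [hAr, if_pos rfl]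
    · intro v hv
      rw [hAv v hv]
      refine incidence_mul_star_self ?_ (hFE (f v).2)
      obtain ⟨x, -, -, h⟩ := hf v hv
      rw [h]
      exact Sym2.mem_mk_left _ _
  rw [hdetA, hδ', star_mul'] at hprod
  refine mul_left_cancel₀ hdr ?_
  rw [← hprod, gramDet_eq_det_mul_star_det W F f]
  ring

end MixedGraph

end

/-! ### The values of `|1 - w|²`. -/

noncomputable section

namespace MixedGraph

variable {V : Type*} {M : MixedGraph V}

/-- The negative of the entry of the Hermitian adjacency matrix that belongs to an arc: a primitive
third root of unity. -/
def negArc : ℂ := -((1 + (√3 : ℝ) * Complex.I) / 2)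

theorem star_negArc : star negArc = -((1 - (√3 : ℝ) * Complex.I) / 2) := by
  apply Complex.ext <;> simp [negArc]

theorem negArc_add_star : negArc + star negArc = -1 := by
  rw [star_negArc, negArc]
  ring

theorem star_negArc_eq_sq : star negArc = negArc ^ 2 := by
  have h3 : ((√3 : ℝ) : ℂ) ^ 2 = 3 := by
    rw [← Complex.ofReal_pow, Real.sq_sqrt (by norm_num)]
    norm_num
  rw [star_negArc, negArc]
  linear_combination (-((√3 : ℝ) : ℂ) ^ 2 / 4) * Complex.I_sq + (1 / 4) * h3

theorem negArc_pow_three : negArc ^ 3 = 1 := by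
  have h1 := negArc_add_star
  rw [star_negArc_eq_sq] at h1
  linear_combination (negArc - 1) * h1

/-- A backward arc contributes `star negArc = negArc ^ 2`, which accounts for the factor 2 in the
exponent. -/
theorem negWeight_eq {u v : V} (p : M.graph.Walk u v) :
    M.negWeight p = negArc ^ (M.forwardCount p + 2 * M.backwardCount p) *
      (-1) ^ M.undirectedCount p := by
  induction p with
  | nil => simp [negWeight, forwardCount, backwardCount, undirectedCount]
  | @cons u v w h p ih =>
    rw [negWeight_cons, ih]
    simp only [forwardCount, backwardCount, undirectedCount, SimpleGraph.Walk.darts_cons,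
      List.countP_cons, decide_eq_true_eq]
    have hasymm := M.arc_asymm u v
    by_cases hu : M.Undirected u v
    · have h1 : ¬ M.arc u v := hu.2.1
      have h2 : ¬ M.arc v u := hu.2.2
      simp only [hermitianAdjacency, hu, h1, h2, decide_true, decide_false, Bool.false_eq_true, if_true,
        if_false, pow_add]
      ring
    by_cases h1 : M.arc u v
    · have h2 := hasymm h1
      simp only [hermitianAdjacency, hu, h1, h2, decide_true, decide_false, Bool.false_eq_true, if_true,
        if_false, pow_add, mul_add]
      rw [← negArc]
      ring
    by_cases h2 : M.arc v u
    · simp only [hermitianAdjacency, hu, h1, h2, decide_true, decide_false, Bool.false_eq_true, if_true,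
        if_false, pow_add, mul_add]
      rw [← star_negArc, star_negArc_eq_sq]
      ring
    · exact absurd ⟨h, h1, h2⟩ hu

open Classical in
-- As `a + 2b ≡ a - b` modulo 3, the residue is 0 or 3 exactly when the power of `negArc` is 1. What
-- remains is `|1 ∓ 1|²`, which is 0 or 4, and `|1 ∓ ω|²` for a primitive cube root of unity `ω`,
-- which is 3 or 1.
theorem one_sub_negWeight_mul_star {u v : V} (p : M.graph.Walk u v) :
    (1 - M.negWeight p) * star (1 - M.negWeight p) =
      if M.residue p ∈ ({0, 3} : Set ℤ) then (if Even (M.undirectedCount p) then 0 else 4)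
      else (if Even (M.undirectedCount p) then 3 else 1) := by
  have h1 := negArc_add_star
  rw [star_negArc_eq_sq] at h1
  have h3 := negArc_pow_three
  have hsign : M.undirectedCount p % 2 = 0 ∧ ((-1 : ℂ)) ^ M.undirectedCount p = 1 ∨
      M.undirectedCount p % 2 = 1 ∧ ((-1 : ℂ)) ^ M.undirectedCount p = -1 := by
    rcases Nat.even_or_odd (M.undirectedCount p) with h | h
    · exact Or.inl ⟨Nat.even_iff.1 h, h.neg_one_pow⟩
    · exact Or.inr ⟨Nat.odd_iff.1 h, h.neg_one_pow⟩
  rw [negWeight_eq]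
  simp only [star_sub, star_one, star_mul', star_pow, star_neg, star_negArc_eq_sq, residue,
    Set.mem_insert_iff, Set.mem_singleton_iff, Nat.even_iff]
  generalize M.forwardCount p = a
  generalize M.backwardCount p = b
  generalize M.undirectedCount p = c at hsign ⊢
  have hdiv : negArc ^ (a + 2 * b) = negArc ^ ((a + 2 * b) % 3) := by
    conv_lhs => rw [← Nat.div_add_mod (a + 2 * b) 3, pow_add, pow_mul, h3, one_pow, one_mul]
  rw [← pow_mul, mul_comm 2 (a + 2 * b), pow_mul, hdiv]
  have hk : (a + 2 * b) % 3 = 0 ∨ (a + 2 * b) % 3 = 1 ∨ (a + 2 * b) % 3 = 2 := by omega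
  rcases hk with hk | hk | hk
  · rw [if_pos (by omega), hk]
    rcases hsign with ⟨hc, hs⟩ | ⟨hc, hs⟩
    · rw [if_pos hc, hs]
      ring
    · rw [if_neg (by omega), hs]
      ring
  all_goals
    rw [if_neg (by omega), hk]
    rcases hsign with ⟨hc, hs⟩ | ⟨hc, hs⟩
    · rw [if_pos hc, hs]
      -- The two alternatives serve the exponents 1 and 2, respectively.
      first
        | linear_combination h3 - h1
        | linear_combination h3 * (negArc ^ 3 - negArc + 1) - h1
    · rw [if_neg (by omega), hs]
      first
        | linear_combination h3 + h1
        | linear_combination h3 * (negArc ^ 3 + negArc + 1) + h1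

end MixedGraph

end

/-! ### Connected graphs with as many edges as vertices. -/

namespace SimpleGraph

variable {W : Type*} {H : SimpleGraph W}

theorem Connected.deleteEdges_of_mem_cycle (hH : H.Connected) {u : W} {c : H.Walk u u}
    (hc : c.IsCycle) {e : Sym2 W} (he : e ∈ c.edges) : (H.deleteEdges {e}).Connected := by
  induction e with
  | _ x y =>
    refine hH.connected_delete_edge_of_not_isBridge ?_
    exact fun hb => hb.notMem_edges_of_isCycle hc he

theorem isAcyclic_deleteEdges_of_forall_cycle {e : Sym2 W}
    (h : ∀ (u : W) (c : H.Walk u u), c.IsCycle → e ∈ c.edges) : (H.deleteEdges {e}).IsAcyclic := by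
  intro u c hc
  have h1 := h u (c.mapLe (H.deleteEdges_le {e})) (hc.mapLe _)
  rw [Walk.edges_mapLe_eq_edges] at h1
  have := c.edges_subset_edgeSet h1
  simp [edgeSet_deleteEdges] at this

theorem card_edgeSet_deleteEdges_singleton [Finite W] {e : Sym2 W} (he : e ∈ H.edgeSet) :
    Nat.card (H.deleteEdges {e}).edgeSet + 1 = Nat.card H.edgeSet := by
  rw [edgeSet_deleteEdges, Nat.card_coe_set_eq, Nat.card_coe_set_eq,
    Set.ncard_sdiff_singleton_add_one he]

theorem Connected.exists_cycle_of_card_edgeSet_eq [Finite W] (hH : H.Connected)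
    (hcard : Nat.card H.edgeSet = Nat.card W) : ∃ (u : W) (c : H.Walk u u), c.IsCycle := by
  by_contra hcon
  push Not at hcon
  have := (isTree_iff_connected_and_card.1 ⟨hH, fun u c hc => hcon u c hc⟩).2
  omega

/-- If an edge of `c` were missing from `c'`, deleting it would leave a connected graph with one
edge fewer than vertices, a tree, still containing `c'`. -/
theorem Connected.edges_subset_of_card_edgeSet_eq [Finite W] (hH : H.Connected)
    (hcard : Nat.card H.edgeSet = Nat.card W) {u v : W} {c : H.Walk u u} (hc : c.IsCycle)
    {c' : H.Walk v v} (hc' : c'.IsCycle) : c.edges ⊆ c'.edges := by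
  intro e he
  by_contra he'
  have h1 := hH.deleteEdges_of_mem_cycle hc he
  have h2 := card_edgeSet_deleteEdges_singleton (c.edges_subset_edgeSet he)
  have h3 : (H.deleteEdges {e}).IsTree :=
    isTree_iff_connected_and_card.2 ⟨h1, by omega⟩
  have hq : ∀ e' ∈ c'.edges, e' ∈ (H.deleteEdges {e}).edgeSet := by
    intro e' h'
    rw [edgeSet_deleteEdges]
    exact ⟨c'.edges_subset_edgeSet h', fun h => he' (by rwa [← Set.mem_singleton_iff.1 h])⟩
  exact h3.isAcyclic _ (hc'.transfer hq)

/-- An edge of `c` lies on every cycle, so deleting it leaves a tree. -/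
theorem Connected.card_edgeSet_eq_of_forall_cycle [Finite W] (hH : H.Connected) {u : W}
    {c : H.Walk u u} (hc : c.IsCycle)
    (h : ∀ (v : W) (c' : H.Walk v v), c'.IsCycle → c.edges ⊆ c'.edges) :
    Nat.card H.edgeSet = Nat.card W := by
  obtain ⟨e, he⟩ : ∃ e, e ∈ c.edges := by
    refine List.exists_mem_of_ne_nil _ fun h0 => hc.ne_nil ?_
    simpa using h0
  have h1 := hH.deleteEdges_of_mem_cycle hc he
  have h2 := card_edgeSet_deleteEdges_singleton (c.edges_subset_edgeSet he)
  have h3 := (isTree_iff_connected_and_card.1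
    ⟨h1, isAcyclic_deleteEdges_of_forall_cycle fun v c' hc' => h v c' hc' he⟩).2
  omega

end SimpleGraph

namespace SimpleGraph

variable {V : Type*}

/-- The edges of the graph that `F` induces on `W` are the elements of `F` with both ends in `W`. -/
theorem card_edgeSet_induce_fromEdgeSet (F : Set (Sym2 V)) (hF : ∀ e ∈ F, ¬ e.IsDiag)
    (W : Set V) : Nat.card ((fromEdgeSet F).induce W).edgeSet =
      {e ∈ F | ∀ x ∈ e, x ∈ W}.ncard := by
  rw [Nat.card_coe_set_eq,
    ← Set.ncard_image_of_injective _ (Sym2.map.injective (Subtype.val_injective (p := (· ∈ W))))]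
  congr 1
  ext e
  constructor
  · rintro ⟨e, he, rfl⟩
    induction e with
    | _ x y =>
      have he' : s(x.1, y.1) ∈ F ∧ x.1 ≠ y.1 := by simpa using he
      refine ⟨he'.1, fun z hz => ?_⟩
      simp only [Sym2.map_mk, Sym2.mem_iff] at hz
      rcases hz with rfl | rfl
      · exact x.2
      · exact y.2
  · induction e with
    | _ x y =>
      rintro ⟨he, hW⟩
      refine ⟨s(⟨x, hW x (Sym2.mem_mk_left x y)⟩, ⟨y, hW y (Sym2.mem_mk_right x y)⟩), ?_, by simp⟩
      simpa using ⟨he, hF _ he⟩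

end SimpleGraph

/-! ### Connected square substructures: rootless trees and unicyclic graphs. -/

noncomputable section

namespace MixedGraph

namespace Substructure

variable {V : Type*} {M : MixedGraph V} {C : M.Substructure}

theorem not_isDiag_of_mem_edges {e : Sym2 V} (he : e ∈ C.edges) : ¬ e.IsDiag :=
  M.graph.not_isDiag_of_mem_edgeSet (C.edges_subset he)

theorem graph_adj {v w : C.verts} : C.graph.Adj v w ↔ s(v.1, w.1) ∈ C.edges := by
  rw [graph, SimpleGraph.induce_adj, SimpleGraph.fromEdgeSet_adj, and_iff_left_iff_imp]
  exact fun h => not_isDiag_of_mem_edges h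

/-- The inclusion of the graph of a substructure. -/
def hom (C : M.Substructure) : C.graph →g M.graph where
  toFun := Subtype.val
  map_rel' h := C.edges_subset (graph_adj.1 h)

theorem hom_injective : Function.Injective C.hom := Subtype.val_injective

theorem card_edgeSet_graph (h : ∀ e ∈ C.edges, ∀ x ∈ e, x ∈ C.verts) :
    Nat.card C.graph.edgeSet = C.edges.ncard := by
  rw [graph, SimpleGraph.card_edgeSet_induce_fromEdgeSet _ fun e => not_isDiag_of_mem_edges]
  congr 1
  ext e
  exact ⟨fun he => he.1, fun he => ⟨he, h e he⟩⟩

theorem isCycleIn_map {u : C.verts} {c : C.graph.Walk u u} (hc : c.IsCycle) :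
    C.IsCycleIn (c.map C.hom) := by
  refine ⟨hc.map hom_injective, ?_, ?_⟩
  · intro x hx
    rw [SimpleGraph.Walk.support_map, List.mem_map] at hx
    obtain ⟨y, -, rfl⟩ := hx
    exact y.2
  · intro e he
    rw [SimpleGraph.Walk.edges_map, List.mem_map] at he
    obtain ⟨e, he, rfl⟩ := he
    have := c.edges_subset_edgeSet he
    induction e with
    | _ x y => exact graph_adj.1 this

/-- This passes from closed walks of `M.graph` to the graph on the subtype, where the edge counts
apply. -/
theorem IsCycleIn.exists_lift {v : V} {p : M.graph.Walk v v} (hp : C.IsCycleIn p) :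
    ∃ (u : C.verts) (c : C.graph.Walk u u), c.IsCycle ∧ c.edges.map (Sym2.map Subtype.val) =
      p.edges := by
  have htr : ∀ e ∈ p.edges, e ∈ (SimpleGraph.fromEdgeSet C.edges).edgeSet := by
    intro e he
    rw [SimpleGraph.edgeSet_fromEdgeSet]
    exact ⟨hp.2.2 e he, not_isDiag_of_mem_edges (hp.2.2 e he)⟩
  have hsupp : ∀ x ∈ (p.transfer _ htr).support, x ∈ C.verts := by
    rw [SimpleGraph.Walk.support_transfer]
    exact hp.2.1
  have hmap := (p.transfer _ htr).map_induce hsupp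
  refine ⟨_, (p.transfer _ htr).induce C.verts hsupp, ?_, ?_⟩
  · have h1 := hp.1.transfer htr
    rw [← hmap] at h1
    exact h1.of_map
  · have h1 := congrArg SimpleGraph.Walk.edges hmap
    rw [SimpleGraph.Walk.edges_map] at h1
    exact h1.trans (SimpleGraph.Walk.edges_transfer _ _)

theorem IsRootlessTree.exists_pendant (h : C.IsRootlessTree) (hne : C.verts.Nonempty) :
    ∃ r ∈ C.verts, ∃ u, u ∉ C.verts ∧ s(r, u) ∈ C.edges := by
  obtain ⟨u, hu, -, htree⟩ := h
  obtain ⟨w, hw⟩ := hne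
  obtain ⟨p⟩ := htree.connected.preconnected ⟨u, Or.inl rfl⟩ ⟨w, Or.inr hw⟩
  cases p with
  | nil => exact absurd hw hu
  | @cons _ x _ hadj q =>
    have hadj' := (SimpleGraph.fromEdgeSet_adj C.edges).1 hadj
    refine ⟨x, ?_, u, hu, ?_⟩
    · exact x.2.resolve_left fun h => hadj'.2 h.symm
    · rw [Sym2.eq_swap]
      exact hadj'.1

theorem IsRootlessTree.not_isUnicyclic (h : C.IsRootlessTree) (hne : C.verts.Nonempty) :
    ¬ C.IsUnicyclic := by
  obtain ⟨r, -, u, hu, he⟩ := h.exists_pendant hne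
  exact fun h' => hu (h'.1 _ he u (Sym2.mem_mk_right r u))

variable [Finite V]

theorem IsUnicyclic.isSquare (h : C.IsUnicyclic) : C.IsSquare := by
  obtain ⟨hin, hconn, s, ⟨v, p, hp, rfl⟩, huniq⟩ := h
  obtain ⟨u, c, hc, hce⟩ := hp.exists_lift
  have h1 := hconn.card_edgeSet_eq_of_forall_cycle hc fun w c' hc' e he => by
    have h2 := huniq _ ⟨_, _, isCycleIn_map hc', rfl⟩
    have h3 : Sym2.map Subtype.val e ∈ p.edges := by
      rw [← hce]
      exact List.mem_map_of_mem he
    have h4 : Sym2.map Subtype.val e ∈ {e | e ∈ (c'.map C.hom).edges} := by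
      rw [h2]
      exact h3
    rw [Set.mem_ofPred_eq, SimpleGraph.Walk.edges_map, List.mem_map] at h4
    obtain ⟨e', he', heq⟩ := h4
    rwa [← Sym2.map.injective Subtype.val_injective heq]
  rw [card_edgeSet_graph hin, Nat.card_coe_set_eq] at h1
  exact h1.symm

theorem isUnicyclic_of_isSquare (hin : ∀ e ∈ C.edges, ∀ x ∈ e, x ∈ C.verts)
    (hconn : C.graph.Connected) (hsq : C.IsSquare) : C.IsUnicyclic := by
  have hcard : Nat.card C.graph.edgeSet = Nat.card C.verts := by
    rw [card_edgeSet_graph hin, Nat.card_coe_set_eq]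
    exact hsq.symm
  have hsub : ∀ {u v : V} {p : M.graph.Walk u u} {q : M.graph.Walk v v}, C.IsCycleIn p →
      C.IsCycleIn q → {e | e ∈ p.edges} ⊆ {e | e ∈ q.edges} := by
    intro u v p q hp hq e he
    obtain ⟨u', c, hc, hce⟩ := hp.exists_lift
    obtain ⟨v', c', hc', hce'⟩ := hq.exists_lift
    rw [Set.mem_ofPred_eq, ← hce, List.mem_map] at he
    obtain ⟨e', he', rfl⟩ := he
    rw [Set.mem_ofPred_eq, ← hce']
    exact List.mem_map_of_mem (hconn.edges_subset_of_card_edgeSet_eq hcard hc hc' he')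
  obtain ⟨u, c, hc⟩ := hconn.exists_cycle_of_card_edgeSet_eq hcard
  refine ⟨hin, hconn, _, ⟨_, _, isCycleIn_map hc, rfl⟩, ?_⟩
  rintro s ⟨v, q, hq, rfl⟩
  exact (hsub hq (isCycleIn_map hc)).antisymm (hsub (isCycleIn_map hc) hq)

theorem IsRootlessTree.isSquare (h : C.IsRootlessTree) : C.IsSquare := by
  obtain ⟨u, hu, hin, htree⟩ := h
  have h1 := (SimpleGraph.isTree_iff_connected_and_card.1 htree).2
  rw [SimpleGraph.card_edgeSet_induce_fromEdgeSet _ fun e => not_isDiag_of_mem_edges,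
    Nat.card_coe_set_eq, Set.ncard_insert_of_notMem hu, Nat.add_right_cancel_iff] at h1
  have h2 : {e ∈ C.edges | ∀ x ∈ e, x ∈ insert u C.verts} = C.edges :=
    Set.sep_eq_self_iff_mem_true.2 hin
  rw [h2] at h1
  exact h1.symm

/-- Connectedness needs at least `|V| - 1` edges inside the vertex set, and `ru` is not one of them.
So all other edges are inner, and adding `u` gives a connected graph with the edge count of a tree.
-/
theorem isRootlessTree_of_isSquare (hconn : C.graph.Connected) (hsq : C.IsSquare) {r u : V}
    (hr : r ∈ C.verts) (hu : u ∉ C.verts) (he : s(r, u) ∈ C.edges) : C.IsRootlessTree := by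
  have h1 := hconn.card_vert_le_card_edgeSet_add_one
  rw [graph, SimpleGraph.card_edgeSet_induce_fromEdgeSet _ fun e => not_isDiag_of_mem_edges,
    Nat.card_coe_set_eq, hsq, ← Set.ncard_sdiff_singleton_add_one he,
    Nat.add_le_add_iff_right] at h1
  have h2 : {e ∈ C.edges | ∀ x ∈ e, x ∈ C.verts} = C.edges \ {s(r, u)} := by
    refine Set.eq_of_subset_of_ncard_le ?_ h1
    rintro e ⟨h3, h4⟩
    refine ⟨h3, ?_⟩
    rintro rfl
    exact hu (h4 u (Sym2.mem_mk_right r u))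
  have hin : ∀ e ∈ C.edges, ∀ x ∈ e, x ∈ insert u C.verts := by
    intro e h3 x hx
    by_cases h4 : e = s(r, u)
    · rw [h4, Sym2.mem_iff] at hx
      rcases hx with rfl | rfl
      · exact Or.inr hr
      · exact Or.inl rfl
    · have h5 : e ∈ C.edges \ {s(r, u)} := ⟨h3, h4⟩
      rw [← h2] at h5
      exact Or.inr (h5.2 x hx)
  refine ⟨u, hu, hin, SimpleGraph.isTree_iff_connected_and_card.2 ⟨?_, ?_⟩⟩
  · rw [Set.insert_eq]
    refine SimpleGraph.connected_induce_union (v := u) (w := r) ?_ hconn.preconnected rfl hr ?_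
    · exact SimpleGraph.Preconnected.of_subsingleton
    · rw [SimpleGraph.fromEdgeSet_adj, Sym2.eq_swap]
      exact ⟨he, fun h => hu (h ▸ hr)⟩
  · have h3 : {e ∈ C.edges | ∀ x ∈ e, x ∈ insert u C.verts} = C.edges :=
      Set.sep_eq_self_iff_mem_true.2 hin
    rw [SimpleGraph.card_edgeSet_induce_fromEdgeSet _ fun e => not_isDiag_of_mem_edges,
      Nat.card_coe_set_eq, Set.ncard_insert_of_notMem hu, h3, hsq]

theorem isRootlessTree_or_isUnicyclic (hconn : C.graph.Connected) (hsq : C.IsSquare)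
    (hmeet : ∀ e ∈ C.edges, ∃ v ∈ C.verts, v ∈ e) : C.IsRootlessTree ∨ C.IsUnicyclic := by
  by_cases hin : ∀ e ∈ C.edges, ∀ x ∈ e, x ∈ C.verts
  · exact Or.inr (isUnicyclic_of_isSquare hin hconn hsq)
  · push Not at hin
    obtain ⟨e, he, u, hue, hu⟩ := hin
    obtain ⟨r, hr, hre⟩ := hmeet e he
    have : e = s(r, u) := (Sym2.mem_and_mem_iff (by rintro rfl; exact hu hr)).1 ⟨hre, hue⟩
    exact Or.inl (isRootlessTree_of_isSquare hconn hsq hr hu (this ▸ he))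

end Substructure

namespace Substructure

variable {V : Type*} [Fintype V] {M : MixedGraph V} {C : M.Substructure}

theorem IsRootlessTree.gramDet_eq_one (h : C.IsRootlessTree) (hconn : C.graph.Connected) :
    M.gramDet C.verts C.edges = 1 := by
  obtain ⟨w⟩ := hconn.nonempty
  obtain ⟨r, hr, u, hu, he⟩ := h.exists_pendant ⟨w, w.2⟩
  exact gramDet_eq_one_of_pendant _ _ C.edges_subset h.isSquare C.graph hconn
    (fun _ _ => graph_adj.1) ⟨r, hr⟩ u hu he

theorem IsUnicyclic.gramDet_eq (h : C.IsUnicyclic) {v : V} {p : M.graph.Walk v v}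
    (hp : C.IsCycleIn p) :
    M.gramDet C.verts C.edges = (1 - M.negWeight p) * star (1 - M.negWeight p) := by
  obtain ⟨u, c, hc, hce⟩ := hp.exists_lift
  cases p with
  | nil => exact absurd rfl hp.1.ne_nil
  | @cons _ u₀ _ h₀ q =>
    have hmem : s(v, u₀) ∈ c.edges.map (Sym2.map Subtype.val) := by
      rw [hce]
      simp
    obtain ⟨e, he, heq⟩ := List.mem_map.1 hmem
    have hnd := hp.1.isTrail.edges_nodup
    rw [SimpleGraph.Walk.edges_cons, List.nodup_cons] at hnd
    refine gramDet_eq_of_closed_walk _ _ C.edges_subset h.1 h.isSquare h₀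
      (hp.2.2 _ (by simp)) q (fun e' he' => ⟨hp.2.2 _ (by simp [he']), ?_⟩) _
      (h.2.1.deleteEdges_of_mem_cycle hc he) fun x y hxy => ?_
    · rintro rfl
      exact hnd.1 he'
    · rw [SimpleGraph.deleteEdges_adj] at hxy
      refine ⟨graph_adj.1 hxy.1, fun h1 => hxy.2 ?_⟩
      rw [← heq] at h1
      exact Sym2.map.injective Subtype.val_injective h1

open Classical in
/-- The contribution of a component to the determinant. -/
theorem gramDet_of_connected (hconn : C.graph.Connected)
    (hmeet : ∀ e ∈ C.edges, ∃ v ∈ C.verts, v ∈ e) (hsq : C.IsSquare) :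
    M.gramDet C.verts C.edges = if C.UnicyclicInPsi4 then 0 else
      (if C.UnicyclicInPsi2 then 3 else 1) * (if C.UnicyclicInPsi3 then 4 else 1) := by
  obtain ⟨w⟩ := hconn.nonempty
  rcases isRootlessTree_or_isUnicyclic hconn hsq hmeet with h | h
  · have hn := h.not_isUnicyclic ⟨w, w.2⟩
    rw [if_neg fun h' => hn h'.1, if_neg fun h' => hn h'.1, if_neg fun h' => hn h'.1,
      h.gramDet_eq_one hconn, one_mul]
  · have hval : ∀ {v : V} {p : M.graph.Walk v v}, C.IsCycleIn p → _ := fun hp =>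
      (h.gramDet_eq hp).trans (one_sub_negWeight_mul_star _)
    have hres : ∀ {v : V} (p : M.graph.Walk v v), M.residue p ∈ ({1, 2, 4, 5} : Set ℤ) ↔
        M.residue p ∉ ({0, 3} : Set ℤ) := by
      intro v p
      simp only [residue, Set.mem_insert_iff, Set.mem_singleton_iff]
      omega
    -- The determinant does not depend on the walk chosen for the cycle, so the distinct values 0, 4
    -- and 3 also show that the three classes exclude one another.
    have h4 : C.UnicyclicInPsi4 → M.gramDet C.verts C.edges = 0 := by
      rintro ⟨-, v, p, hp, h1, h2⟩
      rw [hval hp, if_pos h1, if_pos h2]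
    have h3 : C.UnicyclicInPsi3 → M.gramDet C.verts C.edges = 4 := by
      rintro ⟨-, v, p, hp, h1, h2⟩
      rw [hval hp, if_pos h1, if_neg (Nat.not_even_iff_odd.2 h2)]
    have h2 : C.UnicyclicInPsi2 → M.gramDet C.verts C.edges = 3 := by
      rintro ⟨-, v, p, hp, h1, h2⟩
      rw [hval hp, if_neg ((hres p).1 h1), if_pos h2]
    obtain ⟨v, p, hp⟩ : ∃ (v : V) (p : M.graph.Walk v v), C.IsCycleIn p := by
      obtain ⟨s, ⟨v, p, hp, -⟩, -⟩ := h.2.2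
      exact ⟨v, p, hp⟩
    by_cases hr : M.residue p ∈ ({0, 3} : Set ℤ)
    · by_cases he : Even (M.undirectedCount p)
      · have h1 : C.UnicyclicInPsi4 := ⟨h, v, p, hp, hr, he⟩
        rw [if_pos h1, h4 h1]
      · have h1 : C.UnicyclicInPsi3 := ⟨h, v, p, hp, hr, Nat.not_even_iff_odd.1 he⟩
        have hv := h3 h1
        rw [if_neg fun h' => by rw [h4 h'] at hv; norm_num at hv,
          if_neg fun h' => by rw [h2 h'] at hv; norm_num at hv, if_pos h1, hv, one_mul]
    · by_cases he : Even (M.undirectedCount p)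
      · have h1 : C.UnicyclicInPsi2 := ⟨h, v, p, hp, (hres p).2 hr, he⟩
        have hv := h2 h1
        rw [if_neg fun h' => by rw [h4 h'] at hv; norm_num at hv,
          if_neg (c := C.UnicyclicInPsi3) fun h' => by rw [h3 h'] at hv; norm_num at hv,
          if_pos h1, hv, mul_one]
      · have hv := hval hp
        rw [if_neg hr, if_neg he] at hv
        rw [if_neg fun h' => by rw [h4 h'] at hv; norm_num at hv,
          if_neg fun h' => by rw [h2 h'] at hv; norm_num at hv,
          if_neg fun h' => by rw [h3 h'] at hv; norm_num at hv, hv, one_mul]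

end Substructure

end MixedGraph

end

/-! ### Decomposition into components. -/

noncomputable section

namespace MixedGraph

open Matrix

namespace Substructure

variable {V : Type*} {M : MixedGraph V} {R : M.Substructure}

theorem connected_graph_component (c : R.graph.ConnectedComponent) :
    (R.component c).graph.Connected := by
  let φ : c.toSimpleGraph →g (R.component c).graph :=
    { toFun := fun x => ⟨x.1.1, ⟨x.1, x.2, rfl⟩⟩
      map_rel' := fun {x y} h => by
        have h' : s(x.1.1, y.1.1) ∈ R.edges := graph_adj.1 h
        exact graph_adj.2 ⟨h', x.1.1, ⟨x.1, x.2, rfl⟩, Sym2.mem_mk_left _ _⟩ }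
  have hφ : ∀ y, ∃ x, φ x = y := by
    rintro ⟨_, x, hx, rfl⟩
    exact ⟨⟨x, hx⟩, rfl⟩
  have hc := c.connected_toSimpleGraph
  obtain ⟨x⟩ := hc.nonempty
  have : Nonempty (R.component c).verts := ⟨φ x⟩
  refine ⟨fun u v => ?_⟩
  obtain ⟨x, rfl⟩ := hφ u
  obtain ⟨y, rfl⟩ := hφ v
  exact (hc.preconnected x y).map φ

theorem exists_mem_of_mem_edges_component (c : R.graph.ConnectedComponent) :
    ∀ e ∈ (R.component c).edges, ∃ v ∈ (R.component c).verts, v ∈ e := fun _ he => he.2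

theorem connectedComponentMk_eq {e : Sym2 V} (he : e ∈ R.edges) {i j : R.verts} (hi : i.1 ∈ e)
    (hj : j.1 ∈ e) : R.graph.connectedComponentMk i = R.graph.connectedComponentMk j := by
  by_cases hij : i = j
  · rw [hij]
  · have hs : e = s(i.1, j.1) :=
      (Sym2.mem_and_mem_iff fun h => hij (Subtype.ext h)).1 ⟨hi, hj⟩
    rw [hs] at he
    exact SimpleGraph.ConnectedComponent.sound (graph_adj.2 he).reachable

variable [Fintype V]

theorem ncard_le_sum_ncard_verts_component (R : M.Substructure)
    [Fintype R.graph.ConnectedComponent] :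
    R.verts.ncard ≤ ∑ c, (R.component c).verts.ncard := by
  simp only [← Nat.card_coe_set_eq]
  rw [← Nat.card_sigma]
  refine Nat.card_le_card_of_injective
    (fun v : R.verts => ⟨R.graph.connectedComponentMk v, v.1, v, rfl, rfl⟩) fun v w h => ?_
  have := congrArg (fun x : Σ c, (R.component c).verts => x.2.1) h
  exact Subtype.ext this

/-- The ends of an edge that lie in `R` share a component, so no edge is counted twice; edges
without such an end are not counted at all. -/
theorem sum_ncard_edges_component_le (R : M.Substructure)
    [Fintype R.graph.ConnectedComponent] :
    ∑ c, (R.component c).edges.ncard ≤ R.edges.ncard := by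
  simp only [← Nat.card_coe_set_eq]
  rw [← Nat.card_sigma]
  refine Nat.card_le_card_of_injective
    (fun x : Σ c, (R.component c).edges => (⟨x.2.1, x.2.2.1⟩ : R.edges)) ?_
  rintro ⟨c, e, he⟩ ⟨c', e', he'⟩ h
  obtain rfl : e = e' := congrArg Subtype.val h
  obtain ⟨-, _, ⟨i, rfl, rfl⟩, hi⟩ := id he
  obtain ⟨-, _, ⟨j, rfl, rfl⟩, hj⟩ := id he'
  have hc := connectedComponentMk_eq he.1 hi hj
  generalize hA : R.graph.connectedComponentMk i = A at *
  generalize hB : R.graph.connectedComponentMk j = B at *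
  subst hc
  rfl

open Classical in
-- A nonzero entry needs an edge containing both indices, so the matrix is block diagonal; within a
-- block, edges that miss the component contribute nothing.
theorem gramDet_eq_prod_component (R : M.Substructure) [Fintype R.graph.ConnectedComponent] :
    M.gramDet R.verts R.edges =
      ∏ c, M.gramDet (R.component c).verts (R.component c).edges := by
  rw [gramDet, det_eq_prod_of_block_diagonal _ R.graph.connectedComponentMk]
  · refine Finset.prod_congr rfl fun c _ => ?_
    let g : {v : R.verts // R.graph.connectedComponentMk v = c} ≃ (R.component c).verts :=
      Equiv.ofBijective (fun v => ⟨v.1.1, v.1, v.2, rfl⟩)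
        ⟨fun v w h => Subtype.ext (Subtype.ext (Subtype.mk.inj h)), by
          rintro ⟨_, v, hv, rfl⟩
          exact ⟨⟨v, hv⟩, rfl⟩⟩
    rw [gramDet, ← det_submatrix_equiv_self g]
    congr 1
    ext i j
    simp only [submatrix_apply, Matrix.of_apply]
    symm
    refine Finset.sum_subset (fun e he => ?_) fun e he he' => ?_
    · rw [Set.mem_toFinset] at he ⊢
      exact he.1
    · rw [Set.mem_toFinset] at he he'
      have hi : i.1.1 ∉ e := fun hi => he' ⟨he, i.1.1, ⟨i.1, i.2, rfl⟩, hi⟩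
      exact (congrArg (· * _) (incidence_of_notMem hi)).trans (zero_mul _)
  · intro i j hij
    refine Finset.sum_eq_zero fun e he => ?_
    rw [Set.mem_toFinset] at he
    by_cases hi : i.1 ∈ e
    · rw [incidence_of_notMem (v := j.1) fun hj => hij (connectedComponentMk_eq he hi hj), star_zero,
        mul_zero]
    · rw [incidence_of_notMem hi, zero_mul]

theorem IsSII.isSquare_component (h : R.IsSII) (c : R.graph.ConnectedComponent) :
    (R.component c).IsSquare := by
  rcases h.2.2 c with h | h
  · exact h.isSquare
  · exact h.1.isSquare

open Classical in
theorem gramDet_of_isSquare (hsq : R.IsSquare) :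
    M.gramDet R.verts R.edges = if R.IsSII then (3 : ℂ) ^ R.tau1 * (4 : ℂ) ^ R.tau2 else 0 := by
  have : Fintype R.graph.ConnectedComponent := Fintype.ofFinite _
  by_cases hmeet : ∀ e ∈ R.edges, ∃ v ∈ R.verts, v ∈ e
  swap
  · rw [if_neg fun h => hmeet h.2.1]
    push Not at hmeet
    obtain ⟨e, he, hv⟩ := hmeet
    exact gramDet_eq_zero_of_column_eq_zero _ _ e hsq he fun v h => incidence_of_notMem (hv v h)
  rw [gramDet_eq_prod_component]
  by_cases hall : ∀ c, (R.component c).IsSquare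
  swap
  · rw [if_neg fun h => hall h.isSquare_component]
    -- The components have in total at least as many vertices as edges; if none had fewer edges than
    -- vertices, all would be square.
    obtain ⟨c, hc⟩ : ∃ c, (R.component c).edges.ncard < (R.component c).verts.ncard := by
      by_contra hcon
      push Not at hcon
      refine hall fun c => ?_
      have hle : ∑ c, (R.component c).edges.ncard ≤ ∑ c, (R.component c).verts.ncard :=
        R.sum_ncard_edges_component_le.trans (hsq.symm.le.trans R.ncard_le_sum_ncard_verts_component)
      have heq := le_antisymm (Finset.sum_le_sum fun c _ => hcon c) hle
      exact (Finset.sum_eq_sum_iff_of_le fun c _ => hcon c).1 heq c (Finset.mem_univ c)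
    exact Finset.prod_eq_zero (Finset.mem_univ c) (gramDet_eq_zero_of_ncard_lt _ _ hc)
  have hval := fun c => gramDet_of_connected (connected_graph_component c)
    (exists_mem_of_mem_edges_component c) (hall c)
  by_cases h4 : ∃ c, (R.component c).UnicyclicInPsi4
  · obtain ⟨c, hc⟩ := h4
    rw [Finset.prod_eq_zero (Finset.mem_univ c) (by rw [hval, if_pos hc]), if_neg]
    intro h
    obtain ⟨w⟩ := (connected_graph_component c).nonempty
    rcases h.2.2 c with h | h
    · exact h.not_isUnicyclic ⟨w, w.2⟩ hc.1
    · exact h.2 hc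
  · push Not at h4
    have hSII : R.IsSII := by
      refine ⟨hsq, hmeet, fun c => ?_⟩
      exact (isRootlessTree_or_isUnicyclic (connected_graph_component c) (hall c)
        (exists_mem_of_mem_edges_component c)).imp_right fun h => ⟨h, h4 c⟩
    rw [if_pos hSII, Finset.prod_congr rfl fun c _ => (hval c).trans (if_neg (h4 c)),
      Finset.prod_mul_distrib, Finset.prod_ite, Finset.prod_ite]
    simp only [Finset.prod_const, one_pow, mul_one]
    rw [tau1, tau2, Set.ncard_eq_toFinset_card', Set.ncard_eq_toFinset_card']
    simp

end Substructure

end MixedGraph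

/-! ### Cauchy–Binet for the principal minor, and the sum over substructures. -/

open MixedGraph Matrix in
open Classical in
theorem MixedGraph.det_quasiLaplacian_submatrix {V : Type*} [Fintype V] [DecidableEq V]
    (M : MixedGraph V) (V₁ : Finset V) :
    (M.quasiLaplacian.submatrix (fun v : V₁ => (v : V)) (fun v : V₁ => (v : V))).det =
      ∑ T ∈ Finset.powersetCard V₁.card (Finset.univ : Finset (Sym2 V)),
        M.gramDet (V₁ : Set V) (T : Set (Sym2 V)) := by
  have h : M.quasiLaplacian.submatrix (fun v : V₁ => (v : V)) (fun v : V₁ => (v : V)) =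
      M.incidence.submatrix (fun v : V₁ => (v : V)) id *
        M.incidenceᴴ.submatrix id (fun v : V₁ => (v : V)) := by
    rw [quasiLaplacian_eq_incidence_mul]
    rfl
  rw [h, det_mul_eq_sum_powersetCard, Fintype.card_coe]
  refine Finset.sum_congr rfl fun T _ => ?_
  exact (gramDet_eq_det_of_equiv T
    (Equiv.subtypeEquivRight fun v => Finset.mem_coe.symm : V₁ ≃ (V₁ : Set V))).symm

end

open Classical in
theorem theorem2p8 {V : Type*} [Fintype V] [DecidableEq V] (M : MixedGraph V) (V₁ : Finset V) :
    (M.quasiLaplacian.submatrix (fun v : V₁ => (v : V)) (fun v : V₁ => (v : V))).det =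
      ∑ R : M.Substructure with R.IsSII ∧ R.verts = (V₁ : Set V),
        (3 : ℂ) ^ R.tau1 * (4 : ℂ) ^ R.tau2 := by
  rw [M.det_quasiLaplacian_submatrix]
  symm
  -- Given `V₁`, a substructure is determined by its edges. The remaining sets `T` contribute zero:
  -- either they contain a pair that is not an edge, whose column vanishes, or they give a square
  -- substructure that is not `IsSII`.
  refine Finset.sum_of_injOn (fun R => R.edges.toFinset) ?_ ?_ ?_ ?_
  · intro R hR S hS h
    simp only [Finset.coe_filter, Finset.mem_univ, true_and, Set.mem_ofPred_eq] at hR hS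
    exact MixedGraph.Substructure.ext (hR.2.trans hS.2.symm) (Set.toFinset_inj.1 h)
  · intro R hR
    simp only [Finset.coe_filter, Finset.mem_univ, true_and, Set.mem_ofPred_eq] at hR
    rw [Finset.mem_coe, Finset.mem_powersetCard, ← Set.ncard_eq_toFinset_card', ← hR.1.1, hR.2,
      Set.ncard_coe_finset]
    exact ⟨Finset.subset_univ _, rfl⟩
  · intro T hT hT'
    have hcard : (V₁ : Set V).ncard = (T : Set (Sym2 V)).ncard := by
      rw [Set.ncard_coe_finset, Set.ncard_coe_finset, (Finset.mem_powersetCard.1 hT).2]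
    by_cases hE : (T : Set (Sym2 V)) ⊆ M.graph.edgeSet
    · let R : M.Substructure := ⟨V₁, T, hE⟩
      refine (MixedGraph.Substructure.gramDet_of_isSquare (R := R) hcard).trans (if_neg fun h => ?_)
      exact hT' ⟨R, by simpa using ⟨h, rfl⟩, by simp [R]⟩
    · obtain ⟨e, he, he'⟩ := Set.not_subset.1 hE
      exact MixedGraph.gramDet_eq_zero_of_column_eq_zero _ _ e hcard he fun v _ =>
        MixedGraph.incidence_of_notMem_edgeSet he'
  · intro R hR
    rw [Finset.mem_filter] at hR
    rw [Set.coe_toFinset, ← hR.2.2, MixedGraph.Substructure.gramDet_of_isSquare hR.2.1.1,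
      if_pos hR.2.1]
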